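/- Let $p\ge 1$, $n_0>p$ and $\ell\ge 0$ be integers, and put $n_\ell=n_0 2^\ell$ and $h_\ell=1/n_\ell$. Let $H^1(0,1)$ be the Sobolev space of functions $u\in L^2(0,1)$ with weak derivative $u'\in L^2(0,1)$, with the inner product $(u,v)_A=(u',v')_{L^2(0,1)}+(u,v)_{L^2(0,1)}$ and the norm $\|u\|_{H^1}=(u,u)_A^{1/2}$. Let $S_{p,\ell}(0,1)$ be the space of all functions in $C^{p-1}(0,1)$ that are polynomials of degree at most $p$ on each subinterval $((i-1)h_\ell,ih_\ell)$, $i=1,\dots,n_\ell$, and let $\widetilde S_{p,\ell}(0,1)\subset H^1(0,1)$ be the subspace of those $s\in S_{p,\ell}(0,1)$ with $s^{(2l+1)}(0)=s^{(2l+1)}(1)=0$ (as one-sided limits) for all integers $l\ge 0$ with $2l+1<p$. Let $\widetilde T_\ell:H^1(0,1)\to\widetilde S_{p,\ell}(0,1)$ be the $A$-orthogonal projector onto this finite-dimensional subspace. Then $$\|(I-\widetilde T_\ell)u\|_{L^2(0,1)}\le 2\sqrt2\,h_\ell\,\|u\|_{H^1}\qquad\text{for all }u\in H^1(0,1).$$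 -/

import Mathlib

open MeasureTheory Set Filter Topology
open scoped ContDiff

noncomputable section

namespace SplineApprox

/-- Lebesgue measure on the unit interval `Ω = (0,1)`. -/
abbrev volΩ : Measure ℝ := volume.restrict (Ioo (0 : ℝ) 1)

/-- The Lebesgue space `L²(0,1)` of real-valued functions. -/
abbrev L2 : Type := Lp ℝ 2 volΩ

/-- Test functions on `(0,1)`: smooth functions with compact support contained in `(0,1)`. -/
def IsTestFunction (φ : ℝ → ℝ) : Prop :=
  ContDiff ℝ ∞ φ ∧ HasCompactSupport φ ∧ tsupport φ ⊆ Ioo (0 : ℝ) 1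

/-- `g` is the weak derivative of `u` on `(0,1)`. -/
def IsWeakDeriv (u g : ℝ → ℝ) : Prop :=
  ∀ φ : ℝ → ℝ, IsTestFunction φ →
    ∫ x in Ioo (0 : ℝ) 1, u x * deriv φ x = -∫ x in Ioo (0 : ℝ) 1, g x * φ x

lemma integrable_mul_of_test (u : L2) {ψ : ℝ → ℝ} (hψ : Continuous ψ)
    (hc : HasCompactSupport ψ) : Integrable (fun x => u x * ψ x) volΩ :=
  MemLp.integrable_mul (Lp.memLp u) ((hψ.memLp_of_hasCompactSupport hc (p := 2)))

lemma IsTestFunction.continuous_deriv {φ : ℝ → ℝ} (h : IsTestFunction φ) :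
    Continuous (deriv φ) := h.1.continuous_deriv (by simp)

lemma IsWeakDeriv.add {u v g k : L2} (h₁ : IsWeakDeriv u g) (h₂ : IsWeakDeriv v k) :
    IsWeakDeriv (u + v : L2) (g + k : L2) := by
  intro φ hφ
  have e₁ : ∫ x in Ioo (0 : ℝ) 1, (u + v : L2) x * deriv φ x
      = ∫ x in Ioo (0 : ℝ) 1, (u x * deriv φ x + v x * deriv φ x) := by
    refine integral_congr_ae ?_
    filter_upwards [Lp.coeFn_add u v] with x hx
    rw [hx, Pi.add_apply, add_mul]
  have e₂ : ∫ x in Ioo (0 : ℝ) 1, (g + k : L2) x * φ x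
      = ∫ x in Ioo (0 : ℝ) 1, (g x * φ x + k x * φ x) := by
    refine integral_congr_ae ?_
    filter_upwards [Lp.coeFn_add g k] with x hx
    rw [hx, Pi.add_apply, add_mul]
  rw [e₁, e₂,
    integral_add (integrable_mul_of_test u hφ.continuous_deriv hφ.2.1.deriv)
      (integrable_mul_of_test v hφ.continuous_deriv hφ.2.1.deriv),
    integral_add (integrable_mul_of_test g hφ.1.continuous hφ.2.1)
      (integrable_mul_of_test k hφ.1.continuous hφ.2.1), h₁ φ hφ, h₂ φ hφ]
  ring

lemma IsWeakDeriv.smul (c : ℝ) {u g : L2} (h : IsWeakDeriv u g) :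
    IsWeakDeriv (c • u : L2) (c • g : L2) := by
  intro φ hφ
  have e₁ : ∫ x in Ioo (0 : ℝ) 1, (c • u : L2) x * deriv φ x
      = ∫ x in Ioo (0 : ℝ) 1, c * (u x * deriv φ x) := by
    refine integral_congr_ae ?_
    filter_upwards [Lp.coeFn_smul c u] with x hx
    rw [hx, Pi.smul_apply, smul_eq_mul, mul_assoc]
  have e₂ : ∫ x in Ioo (0 : ℝ) 1, (c • g : L2) x * φ x
      = ∫ x in Ioo (0 : ℝ) 1, c * (g x * φ x) := by
    refine integral_congr_ae ?_
    filter_upwards [Lp.coeFn_smul c g] with x hx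
    rw [hx, Pi.smul_apply, smul_eq_mul, mul_assoc]
  rw [e₁, e₂, integral_const_mul, integral_const_mul, h φ hφ]
  ring

lemma isWeakDeriv_zero : IsWeakDeriv (0 : L2) (0 : L2) := by
  simpa using IsWeakDeriv.smul 0 (u := 0) (g := 0) (fun φ _ => by
    have h0 : ∀ ψ : ℝ → ℝ, ∫ x in Ioo (0 : ℝ) 1, (0 : L2) x * ψ x = 0 := fun ψ => by
      refine integral_eq_zero_of_ae ?_
      filter_upwards [Lp.coeFn_zero ℝ 2 volΩ] with x hx
      rw [hx]; simp
    rw [h0, h0, neg_zero])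

/-- The Sobolev space `H¹(0,1)`: the square integrable functions with square integrable weak
derivative. A function `u` is stored together with its weak derivative, as the pair `(u, u')` in
the Hilbert sum `L² ⊕ L²`; the second component is determined by the first (see
`H1.toL2_injective`). The inherited inner product is `(u, v)_A = (u', v')_{L²} + (u, v)_{L²}`, and
the inherited norm is the `H¹` norm, `‖u‖² = ‖u‖²_{L²} + ‖u'‖²_{L²}`. -/
def H1 : Submodule ℝ (WithLp 2 (L2 × L2)) where
  carrier := {w | IsWeakDeriv w.fst w.snd}
  add_mem' h₁ h₂ := IsWeakDeriv.add h₁ h₂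
  zero_mem' := isWeakDeriv_zero
  smul_mem' c _ h := IsWeakDeriv.smul c h

/-- The embedding `H¹(0,1) → L²(0,1)`. -/
def H1.toL2 : H1 →ₗ[ℝ] L2 where
  toFun u := u.1.fst
  map_add' _ _ := rfl
  map_smul' _ _ := rfl

lemma H1.toL2_injective : Function.Injective H1.toL2 := by
  rw [← LinearMap.ker_eq_bot, LinearMap.ker_eq_bot']
  intro u hu
  have h1 : u.1.fst = 0 := hu
  have h2 : u.1.snd = 0 := by
    have hw : IsWeakDeriv u.1.fst u.1.snd := u.2
    have key : ∀ᵐ x ∂(volume : Measure ℝ), x ∈ Ioo (0 : ℝ) 1 → u.1.snd x = 0 := by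
      refine isOpen_Ioo.ae_eq_zero_of_integral_contDiff_smul_eq_zero ?_ ?_
      · have : IntegrableOn u.1.snd (Ioo (0 : ℝ) 1) :=
          (Lp.memLp u.1.snd).integrable (by norm_num)
        exact this.locallyIntegrableOn
      · intro φ hφ hc hs
        have h := hw φ ⟨hφ, hc, hs⟩
        have h0 : ∫ x in Ioo (0 : ℝ) 1, u.1.fst x * deriv φ x = 0 := by
          refine integral_eq_zero_of_ae ?_
          rw [h1]
          filter_upwards [Lp.coeFn_zero ℝ 2 volΩ] with x hx
          rw [hx]; simp
        rw [h0, eq_comm, neg_eq_zero] at h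
        rw [← h, ← setIntegral_eq_integral_of_forall_compl_eq_zero (s := Ioo (0 : ℝ) 1)]
        · simp only [smul_eq_mul, mul_comm]
        · intro x hx
          have : φ x = 0 := image_eq_zero_of_notMem_tsupport fun h' => hx (hs h')
          simp [this]
    refine Lp.ext ?_
    have key' := (ae_restrict_iff' (measurableSet_Ioo (a := (0 : ℝ)) (b := 1))).2 key
    filter_upwards [key', Lp.coeFn_zero ℝ 2 volΩ] with x hx hx0
    rw [hx, hx0]; rfl
  refine Subtype.ext ?_
  refine (WithLp.equiv 2 (L2 × L2)).injective ?_
  exact Prod.ext h1 h2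

/-- The space of splines of degree `p` and maximum smoothness on the uniform grid with `n`
subintervals of `(0,1)`: the functions in `C^{p-1}(0,1)` that are polynomials of degree at
most `p` on each subinterval `(i/n, (i+1)/n)`. Only the values on `(0,1)` matter. -/
def splineSpace (p n : ℕ) : Submodule ℝ (ℝ → ℝ) where
  carrier := {s | ContDiffOn ℝ ((p - 1 : ℕ) : WithTop ℕ∞) s (Ioo 0 1) ∧
    ∀ i < n, ∃ P : Polynomial ℝ, P.natDegree ≤ p ∧
      ∀ x ∈ Ioo ((i : ℝ) / n) (((i : ℝ) + 1) / n), s x = P.eval x}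
  add_mem' := by
    rintro s t ⟨hs, hs'⟩ ⟨ht, ht'⟩
    refine ⟨hs.add ht, fun i hi => ?_⟩
    obtain ⟨P, hP, hP'⟩ := hs' i hi
    obtain ⟨Q, hQ, hQ'⟩ := ht' i hi
    refine ⟨P + Q, Polynomial.natDegree_add_le_of_degree_le hP hQ, fun x hx => ?_⟩
    simp [hP' x hx, hQ' x hx]
  zero_mem' := ⟨contDiffOn_const, fun i _ => ⟨0, by simp, by simp⟩⟩
  smul_mem' := by
    rintro c s ⟨hs, hs'⟩
    refine ⟨hs.const_smul c, fun i hi => ?_⟩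
    obtain ⟨P, hP, hP'⟩ := hs' i hi
    refine ⟨c • P, (Polynomial.natDegree_smul_le c P).trans hP, fun x hx => ?_⟩
    simp [hP' x hx]

lemma contDiffAt_of_mem_splineSpace {p n k : ℕ} {s : ℝ → ℝ} (hs : s ∈ splineSpace p n)
    (hk : k < p) {x : ℝ} (hx : x ∈ Ioo (0 : ℝ) 1) : ContDiffAt ℝ (k : WithTop ℕ∞) s x :=
  (hs.1.contDiffAt (isOpen_Ioo.mem_nhds hx)).of_le (by exact_mod_cast Nat.le_sub_one_of_lt hk)

/-- The splines all of whose odd derivatives of order less than `p` vanish at the boundary points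
`0` and `1`. The derivatives live on the open interval, their boundary values are the one-sided
limits (which exist, as a spline is a polynomial near either end). -/
def reducedSplineSpace (p n : ℕ) : Submodule ℝ (ℝ → ℝ) where
  carrier := {s | s ∈ splineSpace p n ∧ ∀ l : ℕ, 2 * l + 1 < p →
    Tendsto (iteratedDeriv (2 * l + 1) s) (𝓝[>] 0) (𝓝 0) ∧
    Tendsto (iteratedDeriv (2 * l + 1) s) (𝓝[<] 1) (𝓝 0)}
  add_mem' := by
    rintro s t ⟨hs, hs'⟩ ⟨ht, ht'⟩
    refine ⟨add_mem hs ht, fun l hl => ?_⟩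
    have e : ∀ x ∈ Ioo (0 : ℝ) 1, iteratedDeriv (2 * l + 1) s x + iteratedDeriv (2 * l + 1) t x
        = iteratedDeriv (2 * l + 1) (s + t) x := fun x hx =>
      (iteratedDeriv_add (contDiffAt_of_mem_splineSpace hs hl hx)
        (contDiffAt_of_mem_splineSpace ht hl hx)).symm
    constructor
    · have h := (hs' l hl).1.add (ht' l hl).1
      rw [add_zero] at h
      exact h.congr' (eventually_of_mem (Ioo_mem_nhdsGT one_pos) e)
    · have h := (hs' l hl).2.add (ht' l hl).2
      rw [add_zero] at h
      exact h.congr' (eventually_of_mem (Ioo_mem_nhdsLT one_pos) e)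
  zero_mem' := ⟨zero_mem _, fun l _ => by
    have : iteratedDeriv (2 * l + 1) (0 : ℝ → ℝ) = fun _ => 0 := by
      funext x
      simp
    rw [this]
    exact ⟨tendsto_const_nhds, tendsto_const_nhds⟩⟩
  smul_mem' := by
    rintro c s ⟨hs, hs'⟩
    refine ⟨Submodule.smul_mem _ c hs, fun l hl => ?_⟩
    have e : ∀ x ∈ Ioo (0 : ℝ) 1, c * iteratedDeriv (2 * l + 1) s x
        = iteratedDeriv (2 * l + 1) (c • s) x := fun x hx =>
      (iteratedDeriv_const_smul (contDiffAt_of_mem_splineSpace hs hl hx) c).symm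
    constructor
    · have h := (hs' l hl).1.const_mul c
      rw [mul_zero] at h
      exact h.congr' (eventually_of_mem (Ioo_mem_nhdsGT one_pos) e)
    · have h := (hs' l hl).2.const_mul c
      rw [mul_zero] at h
      exact h.congr' (eventually_of_mem (Ioo_mem_nhdsLT one_pos) e)

/-- The space of splines with vanishing odd boundary derivatives, as a subspace of `H¹(0,1)`
(for `p ≥ 1` every spline is continuous and piecewise polynomial, hence lies in `H¹`). -/
def reducedSplineH1 (p n : ℕ) : Submodule ℝ H1 where
  carrier := {u | ∃ s ∈ reducedSplineSpace p n, H1.toL2 u =ᵐ[volΩ] s}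
  add_mem' := by
    rintro u v ⟨s, hs, hus⟩ ⟨t, ht, hvt⟩
    refine ⟨s + t, add_mem hs ht, ?_⟩
    rw [map_add]
    exact (Lp.coeFn_add _ _).trans (hus.add hvt)
  zero_mem' := ⟨0, zero_mem _, by rw [map_zero]; exact Lp.coeFn_zero ℝ 2 volΩ⟩
  smul_mem' := by
    rintro c u ⟨s, hs, hus⟩
    refine ⟨c • s, Submodule.smul_mem _ c hs, ?_⟩
    rw [map_smul]
    exact (Lp.coeFn_smul _ _).trans (hus.const_smul c)

/-- The monomial `x ^ k` on the `i`-th subinterval of the grid, extended by zero. -/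
def piece (n i k : ℕ) : ℝ → ℝ :=
  (Ioo ((i : ℝ) / n) (((i : ℝ) + 1) / n)).indicator fun x => x ^ k

lemma memLp_piece (n i k : ℕ) : MemLp (piece n i k) 2 volΩ := by
  refine MemLp.indicator measurableSet_Ioo ?_
  refine MemLp.of_bound (by fun_prop) 1 ?_
  filter_upwards [ae_restrict_mem measurableSet_Ioo] with x hx
  rw [norm_pow, Real.norm_eq_abs, abs_of_pos hx.1]
  exact pow_le_one₀ hx.1.le hx.2.le

lemma spline_ae_eq {p n : ℕ} (hn : 0 < n) {s : ℝ → ℝ} (hs : s ∈ splineSpace p n) :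
    ∃ a : Fin n × Fin (p + 1) → ℝ, s =ᵐ[volΩ] fun x => ∑ i, a i * piece n i.1 i.2 x := by
  choose P hP hP' using fun i : Fin n => hs.2 i i.2
  refine ⟨fun i => (P i.1).coeff i.2, ?_⟩
  have hfin : (range fun i : ℕ => (i : ℝ) / n).Countable := countable_range _
  have hn' : (0 : ℝ) < n := by exact_mod_cast hn
  have hnot := ae_restrict_of_ae (s := Ioo (0 : ℝ) 1) (hfin.ae_notMem (volume : Measure ℝ))
  filter_upwards [ae_restrict_mem measurableSet_Ioo, hnot] with x hx hxn
  have hpos : 0 ≤ x * n := mul_nonneg hx.1.le hn'.le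
  have hlt : ⌊x * n⌋₊ < n := by
    rw [Nat.floor_lt hpos]
    nlinarith [hx.2]
  set j : Fin n := ⟨⌊x * n⌋₊, hlt⟩ with hj
  have hxj : x ∈ Ioo (((j : ℕ) : ℝ) / n) ((((j : ℕ) : ℝ) + 1) / n) := by
    constructor
    · refine lt_of_le_of_ne ?_ fun h => hxn ⟨_, h⟩
      rw [div_le_iff₀ hn']
      exact Nat.floor_le hpos
    · rw [lt_div_iff₀ hn']
      exact Nat.lt_floor_add_one _
  have huniq : ∀ i : Fin n, i ≠ j →
      x ∉ Ioo (((i : ℕ) : ℝ) / n) ((((i : ℕ) : ℝ) + 1) / n) := by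
    rintro i hij ⟨h1, h2⟩
    rw [div_lt_iff₀ hn'] at h1
    rw [lt_div_iff₀ hn'] at h2
    refine hij (Fin.ext ?_)
    exact ((Nat.floor_eq_iff hpos).2 ⟨h1.le, h2⟩).symm
  rw [Fintype.sum_prod_type, Finset.sum_eq_single j]
  · rw [hP' j x hxj, Polynomial.eval_eq_sum_range' (Nat.lt_succ_of_le (hP j)),
      ← Fin.sum_univ_eq_sum_range (fun k => (P j).coeff k * x ^ k)]
    refine Finset.sum_congr rfl fun k _ => ?_
    simp only [piece, indicator_of_mem hxj]
  · intro i _ hij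
    refine Finset.sum_eq_zero fun k _ => ?_
    simp only [piece, indicator_of_notMem (huniq i hij), mul_zero]
  · simp

lemma coeFn_sum_L2 {ι : Type} (t : Finset ι) (v : ι → L2) :
    (∑ i ∈ t, v i : L2) =ᵐ[volΩ] fun x => ∑ i ∈ t, v i x := by
  classical
  induction t using Finset.induction_on with
  | empty => simpa using! Lp.coeFn_zero ℝ 2 volΩ
  | insert i t hi ih =>
    rw [Finset.sum_insert hi]
    filter_upwards [Lp.coeFn_add (v i) (∑ j ∈ t, v j), ih] with x hx hx'
    rw [hx, Pi.add_apply, hx', Finset.sum_insert hi]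

lemma finiteDimensional_reducedSplineH1 (p : ℕ) {n : ℕ} (hn : 0 < n) :
    FiniteDimensional ℝ (reducedSplineH1 p n) := by
  let e : Fin n × Fin (p + 1) → L2 := fun ik => (memLp_piece n ik.1 ik.2).toLp _
  let F : Submodule ℝ L2 := Submodule.span ℝ (range e)
  have : FiniteDimensional ℝ F := FiniteDimensional.span_of_finite ℝ (finite_range e)
  have hF : ∀ u : reducedSplineH1 p n, (H1.toL2 ∘ₗ (reducedSplineH1 p n).subtype) u ∈ F := by
    rintro ⟨u, s, hs, hus⟩
    obtain ⟨a, ha⟩ := spline_ae_eq hn hs.1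
    have hu : H1.toL2 u = ∑ i, a i • e i := by
      refine Lp.ext ((hus.trans ha).trans (EventuallyEq.trans ?_ (coeFn_sum_L2 _ _).symm))
      have h1 : ∀ᵐ x ∂volΩ, ∀ i, (a i • e i : L2) x = a i * piece n i.1 i.2 x := by
        refine ae_all_iff.2 fun i => ?_
        filter_upwards [Lp.coeFn_smul (a i) (e i), (memLp_piece n i.1 i.2).coeFn_toLp]
          with x hx hx'
        rw [hx, Pi.smul_apply, hx', smul_eq_mul]
      filter_upwards [h1] with x hx
      exact Finset.sum_congr rfl fun i _ => (hx i).symm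
    change H1.toL2 u ∈ F
    rw [hu]
    exact sum_mem fun i _ => Submodule.smul_mem _ _ (Submodule.subset_span ⟨i, rfl⟩)
  refine FiniteDimensional.of_injective
    ((H1.toL2 ∘ₗ (reducedSplineH1 p n).subtype).codRestrict F hF) ?_
  intro u v huv
  exact Subtype.ext (H1.toL2_injective (congrArg Subtype.val huv))

/-- The `A`-orthogonal projector of `H¹(0,1)` onto the space of splines of degree `p` with
vanishing odd boundary derivatives, on the grid of level `ℓ`, which has `n₀ 2^ℓ` subintervals. -/
def splineProjector (p n₀ ℓ : ℕ) (hn : p < n₀) : H1 →L[ℝ] H1 :=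
  haveI : FiniteDimensional ℝ (reducedSplineH1 p (n₀ * 2 ^ ℓ)) :=
    finiteDimensional_reducedSplineH1 p (Nat.mul_pos (Nat.zero_lt_of_lt hn) (Nat.two_pow_pos ℓ))
  (reducedSplineH1 p (n₀ * 2 ^ ℓ)).starProjection

end SplineApprox

end

/-! The bound is a duality (Aubin–Nitsche) estimate resting on an approximation property that passes
from one spline degree to the next. Let `J` be integration from `0` and `o` the constant `1`.
Integration by parts reads `⟪J f, g⟫ + ⟪f, J g⟫ = ⟪o, f⟫ * ⟪o, g⟫`, so `J` is skew as soon as one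
argument is mean free. Starting from step functions on both sides, even spaces arise as `J` of odd
ones plus constants, and odd spaces as `J` of the mean free even ones.

If primitives are within `h * ‖f‖` of a space `K` and `g` is orthogonal to `K`, then skewness gives
`‖r‖ ^ 2 = -⟪J r, g⟫ = -⟪J r - P (J r), g⟫ ≤ h * ‖r‖ * ‖g‖`, where `P` projects onto `K` and `r` is
`J g`, up to a constant. Thus `J` of a projection error is again of order `h`, which is the
approximation property in the next degree (`exists_splinePair_norm_sub_le`). The constant never
grows with the degree: it remains that of step functions, `1 / n`.

For an error `e` with derivative `f`, `A`-orthogonal to the splines, take `z = -J (J e)`, so that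
`-z'' = e` with Neumann conditions. Then `(z, e)_A = ‖e‖ ^ 2 + ‖J e‖ ^ 2`, and a spline may be
subtracted from `z`. Approximating `z'` by odd splines gives `‖e‖ ≤ h * ‖f‖ + h ^ 2 * ‖e‖`
(`norm_le_of_orthogonal_splinePair`). Since `h ≤ 1`, this yields the factor `√2 * h`.

On the concrete side only one inclusion is needed: the abstract even splines lie in the reduced
spline space, so orthogonality may be tested against them. -/

noncomputable section

namespace SplineApprox

open scoped InnerProductSpace

/-! ### Approximation by induction on the degree, and duality, in an inner product space -/

section Abstract

variable {H : Type*} [NormedAddCommGroup H] [InnerProductSpace ℝ H]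

/-- The even (first component) and odd (second component) spline spaces obtained from the space
`V` of step functions by repeated application of the integration operator `J`; the vector `o`
plays the role of the constant function `1`. -/
def splinePair (J : H →ₗ[ℝ] H) (o : H) (V : Submodule ℝ H) :
    ℕ → Submodule ℝ H × Submodule ℝ H
  | 0 => (V, V)
  | q + 1 => ((splinePair J o V q).2.map J ⊔ Submodule.span ℝ {o},
      ((splinePair J o V q).1 ⊓ (Submodule.span ℝ {o})ᗮ).map J)

variable {J : H →ₗ[ℝ] H} {o : H} {V : Submodule ℝ H} {h : ℝ}

/-- Provides the orthogonal projections onto these spaces without completeness of `H`. -/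
lemma finiteDimensional_splinePair [FiniteDimensional ℝ V] (q : ℕ) :
    FiniteDimensional ℝ (splinePair J o V q).1 ∧ FiniteDimensional ℝ (splinePair J o V q).2 := by
  induction q with
  | zero => exact ⟨‹_›, ‹_›⟩
  | succ q ih =>
    obtain ⟨h1, h2⟩ := ih
    constructor
    · change FiniteDimensional ℝ ↥((splinePair J o V q).2.map J ⊔ Submodule.span ℝ {o})
      infer_instance
    · change FiniteDimensional ℝ
        ↥(((splinePair J o V q).1 ⊓ (Submodule.span ℝ {o})ᗮ).map J)
      infer_instance

/-- Makes projection errors of the even spaces mean free, which is what the odd half of the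
induction integrates. -/
lemma one_mem_splinePair_fst (ho : o ∈ V) (q : ℕ) : o ∈ (splinePair J o V q).1 := by
  cases q with
  | zero => exact ho
  | succ q => exact Submodule.mem_sup_right (Submodule.mem_span_singleton_self o)

lemma norm_sub_starProjection_le {K : Submodule ℝ H} [K.HasOrthogonalProjection] {x v : H}
    (hv : v ∈ K) : ‖x - K.starProjection x‖ ≤ ‖x - v‖ := by
  rw [Submodule.starProjection_minimal]
  exact ciInf_le ⟨0, by rintro _ ⟨w, rfl⟩; exact norm_nonneg _⟩ (⟨v, hv⟩ : K)

/-- Duality argument: if primitives of mean free functions are approximated to order `h` by `K`,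
then integration maps the orthogonal complement of `K` into functions of size `h`. -/
lemma norm_le_of_primitive_of_orthogonal
    (hJ : ∀ f g, ⟪J f, g⟫_ℝ + ⟪f, J g⟫_ℝ = ⟪o, f⟫_ℝ * ⟪o, g⟫_ℝ) (hh : 0 ≤ h)
    {K : Submodule ℝ H} [K.HasOrthogonalProjection] {r f g : H}
    (hK : ‖J r - K.starProjection (J r)‖ ≤ h * ‖r‖) (hr : ‖r‖ ^ 2 = ⟪r, J g⟫_ℝ)
    (hr0 : ⟪o, r⟫_ℝ * ⟪o, g⟫_ℝ = 0) (hg : g = f - K.starProjection f) :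
    ‖r‖ ≤ h * ‖g‖ := by
  -- Skewness moves `J` onto `r`; the projection of `J r` can then be subtracted because `g` is
  -- orthogonal to `K`.
  have h1 : ‖r‖ ^ 2 = -⟪J r - K.starProjection (J r), g⟫_ℝ := by
    have h2 : ⟪K.starProjection (J r), g⟫_ℝ = 0 := by
      rw [real_inner_comm, hg]
      exact K.starProjection_inner_eq_zero _ _ (K.starProjection_apply_mem _)
    rw [inner_sub_left, h2, hr]
    linarith [hJ r g]
  have h3 : ‖r‖ ^ 2 ≤ h * ‖r‖ * ‖g‖ := by
    rw [h1]
    refine (neg_le_abs _).trans ((abs_real_inner_le_norm _ _).trans ?_)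
    gcongr
  rcases (norm_nonneg r).eq_or_lt with h0 | h0
  · rw [← h0]
    positivity
  · nlinarith

lemma inner_one_sub_mean (ho1 : ‖o‖ = 1) (f : H) : ⟪o, f - ⟪o, f⟫_ℝ • o⟫_ℝ = 0 := by
  rw [inner_sub_right, inner_smul_right, real_inner_self_eq_norm_sq, ho1]
  ring

/-- The primitive of the projection error onto the odd spline space. -/
lemma norm_primitive_sub_mean_le
    (hJ : ∀ f g, ⟪J f, g⟫_ℝ + ⟪f, J g⟫_ℝ = ⟪o, f⟫_ℝ * ⟪o, g⟫_ℝ) (ho1 : ‖o‖ = 1) (hh : 0 ≤ h)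
    {K : Submodule ℝ H} [K.HasOrthogonalProjection]
    (hK : ∀ f, ⟪o, f⟫_ℝ = 0 → ‖J f - K.starProjection (J f)‖ ≤ h * ‖f‖) {f g : H}
    (hg : g = f - K.starProjection f) :
    ‖J g - ⟪o, J g⟫_ℝ • o‖ ≤ h * ‖g‖ := by
  have hr0 := inner_one_sub_mean ho1 (J g)
  refine norm_le_of_primitive_of_orthogonal hJ hh (hK _ hr0) ?_ (by rw [hr0, zero_mul]) hg
  have hdec : J g = (J g - ⟪o, J g⟫_ℝ • o) + ⟪o, J g⟫_ℝ • o := (sub_add_cancel _ _).symm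
  generalize J g - ⟪o, J g⟫_ℝ • o = r at hr0 hdec ⊢
  rw [hdec, inner_add_right, inner_smul_right, real_inner_comm o r, hr0, mul_zero, add_zero,
    real_inner_self_eq_norm_sq]

lemma norm_sub_starProjection_self_le {K : Submodule ℝ H} [K.HasOrthogonalProjection] (x : H) :
    ‖x - K.starProjection x‖ ≤ ‖x‖ := by
  simpa using norm_sub_starProjection_le (x := x) K.zero_mem

/-- Primitives are approximated to order `h` by the even and odd spline spaces of any degree as
soon as they are so by step functions. -/
lemma exists_splinePair_norm_sub_le [FiniteDimensional ℝ V]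
    (hJ : ∀ f g, ⟪J f, g⟫_ℝ + ⟪f, J g⟫_ℝ = ⟪o, f⟫_ℝ * ⟪o, g⟫_ℝ) (ho1 : ‖o‖ = 1) (ho : o ∈ V)
    (hh : 0 ≤ h) (hV : ∀ f, ∃ v ∈ V, ‖J f - v‖ ≤ h * ‖f‖) (q : ℕ) :
    (∀ f, ∃ v ∈ (splinePair J o V q).1, ‖J f - v‖ ≤ h * ‖f‖) ∧
    (∀ f, ⟪o, f⟫_ℝ = 0 → ∃ v ∈ (splinePair J o V q).2, ‖J f - v‖ ≤ h * ‖f‖) := by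
  induction q with
  | zero => exact ⟨hV, fun f _ => hV f⟩
  | succ q ih =>
    obtain ⟨hE, hO⟩ := ih
    obtain ⟨_, _⟩ := finiteDimensional_splinePair (J := J) (o := o) (V := V) q
    set E := (splinePair J o V q).1 with hEdef
    set O := (splinePair J o V q).2 with hOdef
    constructor
    · intro f
      have hK : ∀ f, ⟪o, f⟫_ℝ = 0 → ‖J f - O.starProjection (J f)‖ ≤ h * ‖f‖ := fun f hf => by
        obtain ⟨v, hv, hvf⟩ := hO f hf
        exact (norm_sub_starProjection_le hv).trans hvf
      set g := f - O.starProjection f with hg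
      -- Integrate the best odd approximation of `f`; the added constant makes the error mean free.
      refine ⟨J (O.starProjection f) + ⟪o, J g⟫_ℝ • o, ?_, ?_⟩
      · exact Submodule.add_mem_sup
          (Submodule.mem_map_of_mem (Submodule.starProjection_apply_mem _ _))
          (Submodule.smul_mem _ _ (Submodule.mem_span_singleton_self o))
      · rw [← sub_sub, ← map_sub, ← hg]
        refine (norm_primitive_sub_mean_le hJ ho1 hh hK hg).trans ?_
        gcongr
        exact norm_sub_starProjection_self_le f
    · intro f hf
      have hoE : o ∈ E := one_mem_splinePair_fst ho q
      set g := f - E.starProjection f with hg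
      have hog : ⟪o, g⟫_ℝ = 0 := by
        rw [real_inner_comm, hg]
        exact E.starProjection_inner_eq_zero _ _ hoE
      -- The projection of `f` is mean free because both `f` and the error `g` are, so its primitive
      -- is in the next odd space.
      refine ⟨J (E.starProjection f), Submodule.mem_map_of_mem
        ⟨Submodule.starProjection_apply_mem _ _, ?_⟩, ?_⟩
      · rw [SetLike.mem_coe, Submodule.mem_orthogonal_singleton_iff_inner_right]
        rwa [hg, inner_sub_right, hf, zero_sub, neg_eq_zero] at hog
      · rw [← map_sub, ← hg]
        obtain ⟨v, hv, hvf⟩ := hE (J g)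
        refine (norm_le_of_primitive_of_orthogonal hJ hh
          ((norm_sub_starProjection_le hv).trans hvf)
          (real_inner_self_eq_norm_sq _).symm (by rw [hog, mul_zero]) hg).trans ?_
        gcongr
        exact norm_sub_starProjection_self_le f

/-- Aubin--Nitsche estimate: `c • o + J f` is a function with derivative `f`, and `hA` states that
it is orthogonal in the `H¹` inner product to the even spline space of degree `q + 1`. -/
lemma norm_le_of_orthogonal_splinePair [FiniteDimensional ℝ V]
    (hJ : ∀ f g, ⟪J f, g⟫_ℝ + ⟪f, J g⟫_ℝ = ⟪o, f⟫_ℝ * ⟪o, g⟫_ℝ) (ho1 : ‖o‖ = 1) (ho : o ∈ V)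
    (hh : 0 ≤ h) (hV : ∀ f, ∃ v ∈ V, ‖J f - v‖ ≤ h * ‖f‖) {q : ℕ} {e f : H} {c : ℝ}
    (he : e = c • o + J f)
    (hA : ∀ σ ∈ (splinePair J o V q).2, ∀ m : ℝ, ⟪J σ + m • o, e⟫_ℝ + ⟪σ, f⟫_ℝ = 0) :
    ‖e‖ ≤ h * ‖f‖ + h ^ 2 * ‖e‖ := by
  obtain ⟨-, hO⟩ := exists_splinePair_norm_sub_le hJ ho1 ho hh hV q
  obtain ⟨-, _⟩ := finiteDimensional_splinePair (J := J) (o := o) (V := V) q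
  set O := (splinePair J o V q).2 with hOdef
  have hK : ∀ f, ⟪o, f⟫_ℝ = 0 → ‖J f - O.starProjection (J f)‖ ≤ h * ‖f‖ := fun f hf => by
    obtain ⟨v, hv, hvf⟩ := hO f hf
    exact (norm_sub_starProjection_le hv).trans hvf
  -- Test with the constant function.
  have hoe : ⟪o, e⟫_ℝ = 0 := by
    simpa using hA 0 (Submodule.zero_mem _) 1
  -- `-J W` solves the Neumann problem with right-hand side `e`, and `W` vanishes at both ends since
  -- `e` is mean free. The test spline is `J` of the odd projection of `W`; `g` and `r` are the
  -- errors in derivative and value.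
  set W := J e with hW
  set g := W - O.starProjection W with hg
  have hgle : ‖g‖ ≤ h * ‖e‖ := hK e hoe
  have hr := norm_primitive_sub_mean_le hJ ho1 hh hK hg
  set r := J g - ⟪o, J g⟫_ℝ • o with hrdef
  have hA' := hA (O.starProjection W) (Submodule.starProjection_apply_mem _ _) 0
  have h1 : ‖e‖ ^ 2 = -⟪W, f⟫_ℝ := by
    have := hJ e f
    rw [hoe, zero_mul, ← hW] at this
    rw [← real_inner_self_eq_norm_sq]
    nth_rewrite 2 [he]
    rw [inner_add_right, inner_smul_right, real_inner_comm, hoe]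
    linarith
  have h2 : ⟪J W, e⟫_ℝ = -‖W‖ ^ 2 := by
    have := hJ W e
    rw [hoe, mul_zero, ← hW, real_inner_self_eq_norm_sq] at this
    linarith
  have h3 : ⟪r, e⟫_ℝ = ⟪J W, e⟫_ℝ - ⟪J (O.starProjection W), e⟫_ℝ := by
    rw [hrdef, inner_sub_left, inner_smul_left, hoe, hg, map_sub, inner_sub_left]
    simp
  have h4 : ⟪g, f⟫_ℝ = ⟪W, f⟫_ℝ - ⟪O.starProjection W, f⟫_ℝ := by rw [hg, inner_sub_left]
  rw [zero_smul, add_zero] at hA'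
  -- The zero-order term contributes `-‖W‖ ^ 2`, which has the favourable sign and is dropped.
  have h5 : ‖e‖ ^ 2 ≤ -⟪g, f⟫_ℝ - ⟪r, e⟫_ℝ := by nlinarith [sq_nonneg ‖W‖]
  have h6 : -⟪g, f⟫_ℝ ≤ h * ‖e‖ * ‖f‖ := by
    refine (neg_le_abs _).trans ((abs_real_inner_le_norm _ _).trans ?_)
    gcongr
  have h7 : -⟪r, e⟫_ℝ ≤ h * (h * ‖e‖) * ‖e‖ := by
    refine (neg_le_abs _).trans ((abs_real_inner_le_norm _ _).trans ?_)
    gcongr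
    exact hr.trans (by gcongr)
  rcases (norm_nonneg e).eq_or_lt with h0 | h0
  · rw [← h0]
    positivity
  · nlinarith

end Abstract

/-! ### The integration operator on `L²(0,1)` -/

lemma L2.intervalIntegrable (f : L2) : IntervalIntegrable f volume 0 1 := by
  rw [intervalIntegrable_iff_integrableOn_Ioo_of_le zero_le_one]
  exact (Lp.memLp f).integrable (by norm_num)

lemma L2.intervalIntegrable_of_mem (f : L2) {a b : ℝ} (ha : a ∈ Icc (0 : ℝ) 1)
    (hb : b ∈ Icc (0 : ℝ) 1) : IntervalIntegrable f volume a b :=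
  f.intervalIntegrable.mono_set (by
    rw [uIcc_of_le zero_le_one]
    exact uIcc_subset_Icc ha hb)

/-- The primitive of `f` vanishing at `0`. -/
def primFun (f : ℝ → ℝ) (x : ℝ) : ℝ := ∫ t in (0 : ℝ)..x, f t

@[simp] lemma primFun_zero (f : ℝ → ℝ) : primFun f 0 = 0 := by simp [primFun]

lemma absolutelyContinuousOnInterval_primFun (f : L2) :
    AbsolutelyContinuousOnInterval (primFun f) 0 1 :=
  f.intervalIntegrable.absolutelyContinuousOnInterval_intervalIntegral (by simp)

lemma continuousOn_primFun (f : L2) : ContinuousOn (primFun f) (Icc 0 1) := by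
  simpa using (absolutelyContinuousOnInterval_primFun f).continuousOn

lemma memLp_of_continuousOn_Icc {g : ℝ → ℝ} (hg : ContinuousOn g (Icc 0 1)) : MemLp g 2 volΩ := by
  obtain ⟨C, hC⟩ := isCompact_Icc.exists_bound_of_continuousOn hg
  refine MemLp.of_bound
    ((hg.mono Ioo_subset_Icc_self).aestronglyMeasurable measurableSet_Ioo) C ?_
  filter_upwards [ae_restrict_mem measurableSet_Ioo] with x hx
  exact hC x (Ioo_subset_Icc_self hx)

lemma primFun_congr {f g : ℝ → ℝ} (hfg : f =ᵐ[volΩ] g) {x : ℝ} (hx : x ∈ Icc (0 : ℝ) 1) :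
    primFun f x = primFun g x := by
  refine intervalIntegral.integral_congr_ae' ?_ ?_
  · have h1 := (ae_restrict_iff' measurableSet_Ioo).1 hfg
    have h2 : ∀ᵐ t : ℝ, t ≠ 1 := by simp [ae_iff]
    filter_upwards [h1, h2] with t ht h1 ht'
    exact ht ⟨ht'.1, lt_of_le_of_ne (ht'.2.trans hx.2) h1⟩
  · exact Eventually.of_forall fun t ht => absurd (ht.1.trans_le ht.2) hx.1.not_gt

/-- The integration operator `f ↦ ∫₀ˣ f` on `L²(0,1)`. -/
def primL2 : L2 →ₗ[ℝ] L2 where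
  toFun f := (memLp_of_continuousOn_Icc (continuousOn_primFun f)).toLp
  map_add' f g := by
    refine Lp.ext ?_
    filter_upwards [Lp.coeFn_add
      ((memLp_of_continuousOn_Icc (continuousOn_primFun f)).toLp)
      ((memLp_of_continuousOn_Icc (continuousOn_primFun g)).toLp),
      (memLp_of_continuousOn_Icc (continuousOn_primFun f)).coeFn_toLp,
      (memLp_of_continuousOn_Icc (continuousOn_primFun g)).coeFn_toLp,
      (memLp_of_continuousOn_Icc (continuousOn_primFun (f + g))).coeFn_toLp,
      ae_restrict_mem measurableSet_Ioo] with x h1 h2 h3 h4 hx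
    rw [h1, Pi.add_apply, h2, h3, h4, primFun, primFun, primFun,
      ← intervalIntegral.integral_add
        (f.intervalIntegrable_of_mem (by simp) (Ioo_subset_Icc_self hx))
        (g.intervalIntegrable_of_mem (by simp) (Ioo_subset_Icc_self hx))]
    refine intervalIntegral.integral_congr_ae' ?_ ?_
    · have := (ae_restrict_iff' measurableSet_Ioo).1 (Lp.coeFn_add f g)
      filter_upwards [this] with t ht ht'
      exact ht ⟨ht'.1, ht'.2.trans_lt hx.2⟩
    · exact Eventually.of_forall fun t ht => absurd (ht.1.trans_le ht.2) hx.1.not_gt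
  map_smul' c f := by
    refine Lp.ext ?_
    filter_upwards [Lp.coeFn_smul c ((memLp_of_continuousOn_Icc (continuousOn_primFun f)).toLp),
      (memLp_of_continuousOn_Icc (continuousOn_primFun f)).coeFn_toLp,
      (memLp_of_continuousOn_Icc (continuousOn_primFun (c • f))).coeFn_toLp,
      ae_restrict_mem measurableSet_Ioo] with x h1 h2 h3 hx
    rw [RingHom.id_apply, h1, Pi.smul_apply, h2, h3, primFun, primFun, smul_eq_mul,
      ← intervalIntegral.integral_const_mul]
    refine intervalIntegral.integral_congr_ae' ?_ ?_
    · have := (ae_restrict_iff' measurableSet_Ioo).1 (Lp.coeFn_smul c f)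
      filter_upwards [this] with t ht ht'
      exact ht ⟨ht'.1, ht'.2.trans_lt hx.2⟩
    · exact Eventually.of_forall fun t ht => absurd (ht.1.trans_le ht.2) hx.1.not_gt

lemma coeFn_primL2 (f : L2) : primL2 f =ᵐ[volΩ] primFun f :=
  (memLp_of_continuousOn_Icc (continuousOn_primFun f)).coeFn_toLp

/-- The constant function `1`. -/
def oneL2 : L2 := (memLp_of_continuousOn_Icc (g := fun _ => 1) continuousOn_const).toLp

lemma coeFn_oneL2 : oneL2 =ᵐ[volΩ] fun _ => (1 : ℝ) := MemLp.coeFn_toLp _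

lemma inner_eq_intervalIntegral {f g : L2} {F G : ℝ → ℝ} (hF : f =ᵐ[volΩ] F) (hG : g =ᵐ[volΩ] G) :
    ⟪f, g⟫_ℝ = ∫ x in (0 : ℝ)..1, F x * G x := by
  rw [L2.inner_def, intervalIntegral.integral_of_le zero_le_one, integral_Ioc_eq_integral_Ioo]
  refine integral_congr_ae ?_
  filter_upwards [hF, hG] with x h1 h2
  simp [h1, h2, mul_comm]

lemma inner_oneL2 (f : L2) : ⟪oneL2, f⟫_ℝ = primFun f 1 := by
  rw [inner_eq_intervalIntegral coeFn_oneL2 (ae_eq_refl _), primFun]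
  simp

lemma norm_oneL2 : ‖oneL2‖ = 1 := by
  have h : ‖oneL2‖ ^ 2 = 1 := by
    rw [← real_inner_self_eq_norm_sq, inner_eq_intervalIntegral coeFn_oneL2 coeFn_oneL2]
    simp
  nlinarith [norm_nonneg oneL2]

lemma ae_deriv_primFun (f : L2) : ∀ᵐ x, x ∈ Ioc (0 : ℝ) 1 → deriv (primFun f) x = f x := by
  filter_upwards [f.intervalIntegrable.ae_hasDerivAt_integral] with x hx hx'
  exact (hx (by rw [uIcc_of_le zero_le_one]; exact Ioc_subset_Icc_self hx') 0 (by simp)).deriv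

/-- Integration by parts for absolutely continuous primitives: the boundary term at `0` vanishes,
and the one at `1` is the product of the two means. -/
lemma inner_primL2_add (f g : L2) :
    ⟪primL2 f, g⟫_ℝ + ⟪f, primL2 g⟫_ℝ = ⟪oneL2, f⟫_ℝ * ⟪oneL2, g⟫_ℝ := by
  have h := (absolutelyContinuousOnInterval_primFun f).integral_mul_deriv_eq_deriv_mul
    (absolutelyContinuousOnInterval_primFun g)
  rw [inner_eq_intervalIntegral (coeFn_primL2 f) (ae_eq_refl g),
    inner_eq_intervalIntegral (ae_eq_refl f) (coeFn_primL2 g), inner_oneL2, inner_oneL2]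
  have h1 : ∫ x in (0 : ℝ)..1, primFun f x * deriv (primFun g) x
      = ∫ x in (0 : ℝ)..1, primFun f x * g x := by
    refine intervalIntegral.integral_congr_ae ?_
    rw [uIoc_of_le zero_le_one]
    filter_upwards [ae_deriv_primFun g] with x hx hx'
    rw [hx hx']
  have h2 : ∫ x in (0 : ℝ)..1, deriv (primFun f) x * primFun g x
      = ∫ x in (0 : ℝ)..1, f x * primFun g x := by
    refine intervalIntegral.integral_congr_ae ?_
    rw [uIoc_of_le zero_le_one]
    filter_upwards [ae_deriv_primFun f] with x hx hx'
    rw [hx hx']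
  rw [← h1, ← h2, h]
  simp

/-! ### Weak derivatives and primitives -/

/-- A test function is the primitive of its derivative. -/
lemma IsTestFunction.primFun_deriv {φ : ℝ → ℝ} (hφ : IsTestFunction φ) (x : ℝ) :
    primFun (deriv φ) x = φ x := by
  rw [primFun, intervalIntegral.integral_deriv_eq_sub
    (fun y _ => (hφ.1.differentiable (by simp)).differentiableAt)
    (hφ.continuous_deriv.intervalIntegrable _ _)]
  have : φ 0 = 0 := image_eq_zero_of_notMem_tsupport fun h => (hφ.2.2 h).1.false
  rw [this, sub_zero]

lemma IsTestFunction.apply_one {φ : ℝ → ℝ} (hφ : IsTestFunction φ) : φ 1 = 0 :=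
  image_eq_zero_of_notMem_tsupport fun h => (hφ.2.2 h).2.false

/-- Affine primitives have the expected weak derivative. -/
lemma isWeakDeriv_primL2_add (f : L2) (c : ℝ) :
    IsWeakDeriv (primL2 f + c • oneL2 : L2) f := by
  intro φ hφ
  let d : L2 := (hφ.continuous_deriv.memLp_of_hasCompactSupport hφ.2.1.deriv).toLp
  have hd : d =ᵐ[volΩ] deriv φ := MemLp.coeFn_toLp _
  have hd' : ∀ x ∈ Icc (0 : ℝ) 1, primFun d x = φ x := fun x hx => by
    rw [← hφ.primFun_deriv, primFun_congr hd hx]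
  have hpd : primL2 d =ᵐ[volΩ] φ := by
    filter_upwards [coeFn_primL2 d, ae_restrict_mem measurableSet_Ioo] with x h1 hx
    rw [h1, hd' x (Ioo_subset_Icc_self hx)]
  have h0 : ⟪oneL2, d⟫_ℝ = 0 := by rw [inner_oneL2, hd' 1 (by simp), hφ.apply_one]
  have h := inner_primL2_add f d
  rw [← integral_Ioc_eq_integral_Ioo, ← integral_Ioc_eq_integral_Ioo,
    ← intervalIntegral.integral_of_le zero_le_one, ← intervalIntegral.integral_of_le zero_le_one,
    ← inner_eq_intervalIntegral (ae_eq_refl _) hd, ← inner_eq_intervalIntegral (ae_eq_refl _) hpd,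
    inner_add_left, inner_smul_left, h0]
  rw [h0] at h
  simp
  linarith

/-- Primitive of a mean free test function. -/
lemma exists_isTestFunction_deriv_eq {ψ : ℝ → ℝ} (hψ : IsTestFunction ψ)
    (h0 : ∫ x in (0 : ℝ)..1, ψ x = 0) : ∃ φ, IsTestFunction φ ∧ deriv φ = ψ := by
  have hder : ∀ x, HasDerivAt (primFun ψ) (ψ x) x := fun x =>
    intervalIntegral.integral_hasDerivAt_right (hψ.1.continuous.intervalIntegrable _ _)
      (hψ.1.continuous.stronglyMeasurableAtFilter _ _) hψ.1.continuous.continuousAt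
  have hder' : deriv (primFun ψ) = ψ := funext fun x => (hder x).deriv
  -- A closed interval strictly inside `(0,1)` that will also contain the support of the primitive.
  obtain ⟨a, b, ha, hb, hab⟩ : ∃ a b : ℝ, 0 < a ∧ b < 1 ∧ tsupport ψ ⊆ Icc a b := by
    rcases (tsupport ψ).eq_empty_or_nonempty with he | hne
    · exact ⟨1 / 2, 1 / 2, by norm_num, by norm_num, by simp [he]⟩
    · have hc : IsCompact (tsupport ψ) := hψ.2.1
      obtain ⟨a, ha, ha'⟩ := hc.exists_isLeast hne
      obtain ⟨b, hb, hb'⟩ := hc.exists_isGreatest hne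
      exact ⟨a, b, (hψ.2.2 ha).1, (hψ.2.2 hb).2, fun x hx => ⟨ha' hx, hb' hx⟩⟩
  have hz : ∀ x, x ∉ Icc a b → ψ x = 0 := fun x hx =>
    image_eq_zero_of_notMem_tsupport fun h => hx (hab h)
  have hsupp : ∀ x, x ∉ Icc a b → primFun ψ x = 0 := by
    intro x hx
    rw [mem_Icc, not_and_or, not_le, not_le] at hx
    rcases hx with hx | hx
    · have h1 : ∫ t in (0 : ℝ)..x, ψ t = ∫ t in (0 : ℝ)..x, (0 : ℝ) :=
        intervalIntegral.integral_congr fun t ht => hz t fun h =>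
          absurd (h.1.trans ht.2) (max_lt ha hx).not_ge
      rw [primFun, h1, intervalIntegral.integral_zero]
    · have h1 : ∫ t in x..1, ψ t = 0 := by
        rw [← intervalIntegral.integral_zero (a := x) (b := 1)]
        refine intervalIntegral.integral_congr fun t ht => hz t fun h => ?_
        exact absurd ((lt_min hx hb).trans_le (ht.1.trans h.2)) (lt_irrefl _)
      -- Right of the support the primitive equals the full integral, which is zero.
      have h2 := intervalIntegral.integral_add_adjacent_intervals
        (hψ.1.continuous.intervalIntegrable (μ := volume) 0 x)
        (hψ.1.continuous.intervalIntegrable x 1)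
      rw [primFun]
      linarith
  have hts : tsupport (primFun ψ) ⊆ Icc a b :=
    closure_minimal (fun x hx => by_contra fun h => hx (hsupp x h)) isClosed_Icc
  refine ⟨primFun ψ, ⟨?_, ?_, ?_⟩, hder'⟩
  · rw [contDiff_infty_iff_deriv, hder']
    exact ⟨fun x => (hder x).differentiableAt, hψ.1⟩
  · exact isCompact_Icc.of_isClosed_subset (isClosed_tsupport _) hts
  · exact hts.trans fun x hx => ⟨ha.trans_le hx.1, hx.2.trans_lt hb⟩

lemma exists_isTestFunction_integral_eq_one :
    ∃ η, IsTestFunction η ∧ ∫ x in (0 : ℝ)..1, η x = 1 := by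
  let B : ContDiffBump (1 / 2 : ℝ) := ⟨1 / 8, 1 / 4, by norm_num, by norm_num⟩
  have hts : tsupport (B.normed volume) ⊆ Ioo (0 : ℝ) 1 := by
    rw [B.tsupport_normed_eq, Real.closedBall_eq_Icc]
    intro x hx
    constructor <;> norm_num [B] at hx ⊢ <;> linarith [hx.1, hx.2]
  refine ⟨B.normed volume, ⟨B.contDiff_normed, B.hasCompactSupport_normed, hts⟩, ?_⟩
  rw [intervalIntegral.integral_of_le zero_le_one]
  refine Eq.trans ?_ (B.integral_normed (μ := volume))
  refine setIntegral_eq_integral_of_forall_compl_eq_zero fun x hx =>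
    image_eq_zero_of_notMem_tsupport fun h => hx (Ioo_subset_Ioc_self (hts h))

lemma IsTestFunction.sub_smul {φ ψ : ℝ → ℝ} (hφ : IsTestFunction φ) (hψ : IsTestFunction ψ)
    (c : ℝ) : IsTestFunction (fun x => φ x - c * ψ x) := by
  have hK : tsupport (fun x => φ x - c * ψ x) ⊆ tsupport φ ∪ tsupport ψ :=
    closure_minimal (fun x hx => by
      by_contra h
      rw [mem_union, not_or] at h
      apply hx
      simp [image_eq_zero_of_notMem_tsupport h.1, image_eq_zero_of_notMem_tsupport h.2])
      ((isClosed_tsupport _).union (isClosed_tsupport _))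
  refine ⟨hφ.1.sub (contDiff_const.mul hψ.1), ?_, hK.trans (union_subset hφ.2.2 hψ.2.2)⟩
  exact (hφ.2.1.union hψ.2.1).of_isClosed_subset (isClosed_tsupport _) hK

/-- The lemma of du Bois-Reymond. -/
lemma exists_eq_smul_oneL2 {u : L2}
    (hu : ∀ φ, IsTestFunction φ → ∫ x in (0 : ℝ)..1, u x * deriv φ x = 0) :
    ∃ c : ℝ, u = c • oneL2 := by
  obtain ⟨η, hη, hη1⟩ := exists_isTestFunction_integral_eq_one
  have hint : ∀ ψ, IsTestFunction ψ → IntervalIntegrable (fun x => u x * ψ x) volume 0 1 :=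
    fun ψ hψ => u.intervalIntegrable.mul_continuousOn hψ.1.continuous.continuousOn
  set c := ∫ x in (0 : ℝ)..1, u x * η x with hc
  refine ⟨c, ?_⟩
  have key : ∀ᵐ x ∂(volume : Measure ℝ), x ∈ Ioo (0 : ℝ) 1 → u x - c = 0 := by
    refine isOpen_Ioo.ae_eq_zero_of_integral_contDiff_smul_eq_zero ?_ ?_
    · have : IntegrableOn u (Ioo (0 : ℝ) 1) := (Lp.memLp u).integrable (by norm_num)
      exact (this.sub (integrableOn_const (by simp))).locallyIntegrableOn
    · intro ψ hψ hcs hs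
      have hψ' : IsTestFunction ψ := ⟨hψ, hcs, hs⟩
      set m := ∫ x in (0 : ℝ)..1, ψ x with hm
      -- Subtracting `m * η` removes the mean, so the result is the derivative of a test function.
      obtain ⟨φ, hφ, hφ'⟩ := exists_isTestFunction_deriv_eq (hψ'.sub_smul hη m) (by
        rw [intervalIntegral.integral_sub (hψ.continuous.intervalIntegrable _ _)
          ((hη.1.continuous.const_mul _).intervalIntegrable _ _),
          intervalIntegral.integral_const_mul, hη1, ← hm]
        ring)
      have h := hu φ hφ
      have e : (fun x => u x * deriv φ x) = fun x => u x * ψ x - m * (u x * η x) := by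
        funext x
        rw [hφ']
        ring
      rw [e, intervalIntegral.integral_sub (hint ψ hψ') ((hint η hη).const_mul m),
        intervalIntegral.integral_const_mul, ← hc] at h
      rw [← setIntegral_eq_integral_of_forall_compl_eq_zero (s := Ioc (0 : ℝ) 1),
        ← intervalIntegral.integral_of_le zero_le_one]
      · have e' : (fun x => ψ x • (u x - c)) = fun x => u x * ψ x - c * ψ x := by
          funext x
          rw [smul_eq_mul]
          ring
        rw [e', intervalIntegral.integral_sub (hint ψ hψ')
          ((hψ.continuous.const_mul _).intervalIntegrable _ _),
          intervalIntegral.integral_const_mul, ← hm]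
        linarith
      · intro x hx
        rw [image_eq_zero_of_notMem_tsupport fun h' => hx (Ioo_subset_Ioc_self (hs h')), zero_smul]
  refine Lp.ext ?_
  filter_upwards [(ae_restrict_iff' measurableSet_Ioo).2 key, Lp.coeFn_smul c oneL2, coeFn_oneL2]
    with x h1 h2 h3
  rw [h2, Pi.smul_apply, h3, smul_eq_mul, mul_one]
  linarith

/-- Functions with a weak derivative are primitives. -/
lemma exists_eq_smul_oneL2_add_primL2 {u g : L2} (hu : IsWeakDeriv u g) :
    ∃ c : ℝ, u = c • oneL2 + primL2 g := by
  obtain ⟨c, hc⟩ := exists_eq_smul_oneL2 (u := u - primL2 g) (fun φ hφ => by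
    have h1 := (hu.add ((isWeakDeriv_primL2_add g 0).smul (-1))) φ hφ
    have e : u + (-1 : ℝ) • (primL2 g + (0 : ℝ) • oneL2) = u - primL2 g := by
      rw [zero_smul, add_zero, neg_one_smul, sub_eq_add_neg]
    have e' : g + (-1 : ℝ) • g = 0 := by rw [neg_one_smul, add_neg_cancel]
    rw [e, e'] at h1
    rw [intervalIntegral.integral_of_le zero_le_one, integral_Ioc_eq_integral_Ioo, h1,
      neg_eq_zero]
    refine integral_eq_zero_of_ae ?_
    filter_upwards [Lp.coeFn_zero ℝ 2 volΩ] with x hx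
    rw [hx]; simp)
  exact ⟨c, by rw [← hc, sub_add_cancel]⟩

/-! ### Step functions: the base case of the approximation property -/

/-- Piecewise constant functions on the uniform grid with `n` subintervals. -/
def stepSpace (n : ℕ) : Submodule ℝ L2 :=
  Submodule.span ℝ (range fun i : Fin n => (memLp_piece n i 0).toLp (piece n i 0))

instance (n : ℕ) : FiniteDimensional ℝ (stepSpace n) :=
  FiniteDimensional.span_of_finite ℝ (finite_range _)

lemma sum_mul_piece {n : ℕ} (hn : 0 < n) (A : ℕ → ℝ) {i : ℕ} (hi : i < n) {x : ℝ}
    (hx : x ∈ Ioo ((i : ℝ) / n) (((i : ℝ) + 1) / n)) :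
    ∑ j : Fin n, A j * piece n j 0 x = A i := by
  have hn' : (0 : ℝ) < n := by exact_mod_cast hn
  rw [Finset.sum_eq_single (⟨i, hi⟩ : Fin n)]
  · simp only [piece, indicator_of_mem hx, pow_zero, mul_one]
  · rintro j - hj
    have : x ∉ Ioo (((j : ℕ) : ℝ) / n) ((((j : ℕ) : ℝ) + 1) / n) := by
      rintro ⟨h1, h2⟩
      obtain ⟨h3, h4⟩ := hx
      rw [div_lt_iff₀ hn'] at h1 h3
      rw [lt_div_iff₀ hn'] at h2 h4
      have h5 : ((j : ℕ) : ℝ) < i + 1 := h1.trans h4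
      have h6 : (i : ℝ) < (j : ℕ) + 1 := h3.trans h2
      norm_cast at h5 h6
      exact hj (Fin.ext (by simp; omega))
    simp only [piece, indicator_of_notMem this, mul_zero]
  · simp

/-- The step function with prescribed values on the subintervals. -/
lemma exists_mem_stepSpace {n : ℕ} (hn : 0 < n) (A : ℕ → ℝ) :
    ∃ v ∈ stepSpace n, ∀ᵐ x ∂volΩ, ∀ i < n,
      x ∈ Ioo ((i : ℝ) / n) (((i : ℝ) + 1) / n) → v x = A i := by
  refine ⟨∑ j : Fin n, A j • (memLp_piece n j 0).toLp (piece n j 0),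
    sum_mem fun j _ => Submodule.smul_mem _ _ (Submodule.subset_span ⟨j, rfl⟩), ?_⟩
  have h1 : ∀ᵐ x ∂volΩ, ∀ j : Fin n,
      (A j • (memLp_piece n j 0).toLp (piece n j 0) : L2) x = A j * piece n j 0 x := by
    refine ae_all_iff.2 fun j => ?_
    filter_upwards [Lp.coeFn_smul (A j) ((memLp_piece n j 0).toLp (piece n j 0)),
      (memLp_piece n j 0).coeFn_toLp] with x hx hx'
    rw [hx, Pi.smul_apply, hx', smul_eq_mul]
  filter_upwards [h1, coeFn_sum_L2 Finset.univ
    (fun j : Fin n => A j • (memLp_piece n j 0).toLp (piece n j 0))] with x hx hx' i hi hxi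
  rw [hx', Finset.sum_congr rfl fun j _ => hx j, sum_mul_piece hn A hi hxi]

/-- Almost every point lies in the interior of some subinterval. -/
lemma ae_exists_mem_Ioo {n : ℕ} (hn : 0 < n) :
    ∀ᵐ x ∂volΩ, ∃ i < n, x ∈ Ioo ((i : ℝ) / n) (((i : ℝ) + 1) / n) := by
  have hn' : (0 : ℝ) < n := by exact_mod_cast hn
  have hfin : (range fun i : ℕ => (i : ℝ) / n).Countable := countable_range _
  filter_upwards [ae_restrict_mem measurableSet_Ioo,
    ae_restrict_of_ae (hfin.ae_notMem (volume : Measure ℝ))] with x hx hxn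
  have hpos : 0 ≤ x * n := mul_nonneg hx.1.le hn'.le
  refine ⟨⌊x * n⌋₊, ?_, ?_, ?_⟩
  · rw [Nat.floor_lt hpos]
    nlinarith [hx.2]
  · refine lt_of_le_of_ne ?_ fun h => hxn ⟨_, h⟩
    rw [div_le_iff₀ hn']
    exact Nat.floor_le hpos
  · rw [lt_div_iff₀ hn']
    exact Nat.lt_floor_add_one _

lemma oneL2_mem_stepSpace {n : ℕ} (hn : 0 < n) : oneL2 ∈ stepSpace n := by
  obtain ⟨v, hv, hv'⟩ := exists_mem_stepSpace hn fun _ => 1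
  convert hv
  refine Lp.ext ?_
  filter_upwards [hv', ae_exists_mem_Ioo hn, coeFn_oneL2] with x h1 ⟨i, hi, hx⟩ h2
  rw [h1 i hi hx, h2]

/-- Cauchy–Schwarz against `1`, from expanding the nonnegative integral of `(f - m) ^ 2` with `m`
the mean of `f`. -/
lemma sq_intervalIntegral_le {f : ℝ → ℝ} {a b : ℝ} (hab : a ≤ b)
    (hf : IntervalIntegrable f volume a b) (hf2 : IntervalIntegrable (fun x => f x ^ 2) volume a b) :
    (∫ x in a..b, f x) ^ 2 ≤ (b - a) * ∫ x in a..b, f x ^ 2 := by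
  rcases hab.eq_or_lt with rfl | hlt
  · simp
  set m := (∫ x in a..b, f x) / (b - a) with hm
  have hba : 0 < b - a := sub_pos.2 hlt
  have h0 : 0 ≤ ∫ x in a..b, (f x - m) ^ 2 :=
    intervalIntegral.integral_nonneg hab fun x _ => sq_nonneg _
  have e : (fun x => (f x - m) ^ 2) = fun x => f x ^ 2 - 2 * m * f x + m ^ 2 := by
    funext x
    ring
  rw [e, intervalIntegral.integral_add (hf2.sub (hf.const_mul _)) intervalIntegrable_const,
    intervalIntegral.integral_sub hf2 (hf.const_mul _), intervalIntegral.integral_const_mul,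
    intervalIntegral.integral_const, smul_eq_mul] at h0
  have h1 : ∫ x in a..b, f x = m * (b - a) := by rw [hm, div_mul_cancel₀ _ hba.ne']
  rw [h1] at h0 ⊢
  nlinarith

lemma L2.intervalIntegrable_sq_of_mem (f : L2) {a b : ℝ} (ha : a ∈ Icc (0 : ℝ) 1)
    (hb : b ∈ Icc (0 : ℝ) 1) : IntervalIntegrable (fun x => f x ^ 2) volume a b := by
  have h : IntervalIntegrable (fun x => f x ^ 2) volume 0 1 := by
    rw [intervalIntegrable_iff_integrableOn_Ioo_of_le zero_le_one]
    exact (Lp.memLp f).integrable_sq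
  refine h.mono_set ?_
  rw [uIcc_of_le zero_le_one]
  exact uIcc_subset_Icc ha hb

lemma norm_sq_eq_sum (f : L2) {n : ℕ} (hn : 0 < n) :
    ‖f‖ ^ 2 = ∑ i ∈ Finset.range n, ∫ x in ((i : ℝ) / n)..(((i + 1 : ℕ) : ℝ) / n), f x ^ 2 := by
  have hn' : (0 : ℝ) < n := by exact_mod_cast hn
  have hmem : ∀ i ≤ n, (i : ℝ) / n ∈ Icc (0 : ℝ) 1 := fun i hi =>
    ⟨by positivity, by rw [div_le_one hn']; exact_mod_cast hi⟩
  rw [intervalIntegral.sum_integral_adjacent_intervals (a := fun i : ℕ => (i : ℝ) / n)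
    fun i hi => f.intervalIntegrable_sq_of_mem (hmem i hi.le) (hmem (i + 1) hi),
    ← real_inner_self_eq_norm_sq, inner_eq_intervalIntegral (ae_eq_refl f) (ae_eq_refl f)]
  simp only [Nat.cast_zero, zero_div, div_self hn'.ne', sq]

/-- Piecewise constant approximation of primitives. -/
lemma exists_stepSpace_norm_sub_le {n : ℕ} (hn : 0 < n) (f : L2) :
    ∃ v ∈ stepSpace n, ‖primL2 f - v‖ ≤ 1 / n * ‖f‖ := by
  have hn' : (0 : ℝ) < n := by exact_mod_cast hn
  have hmem : ∀ i ≤ n, (i : ℝ) / n ∈ Icc (0 : ℝ) 1 := fun i hi =>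
    ⟨by positivity, by rw [div_le_one hn']; exact_mod_cast hi⟩
  -- On each cell take the value of the primitive at the left node.
  obtain ⟨v, hv, hv'⟩ := exists_mem_stepSpace hn fun i => primFun f ((i : ℝ) / n)
  refine ⟨v, hv, ?_⟩
  refine le_of_sq_le_sq ?_ (by positivity)
  rw [mul_pow, norm_sq_eq_sum _ hn, norm_sq_eq_sum f hn, Finset.mul_sum]
  refine Finset.sum_le_sum fun i hi => ?_
  have hi' : i < n := Finset.mem_range.1 hi
  have hlen : ((i + 1 : ℕ) : ℝ) / n - (i : ℝ) / n = 1 / n := by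
    push_cast
    ring
  have hle : (i : ℝ) / n ≤ ((i + 1 : ℕ) : ℝ) / n := by
    have : 0 < 1 / (n : ℝ) := by positivity
    linarith
  set a := (i : ℝ) / n with ha
  set b := ((i + 1 : ℕ) : ℝ) / n with hb
  have ham : a ∈ Icc (0 : ℝ) 1 := hmem i hi'.le
  have hbm : b ∈ Icc (0 : ℝ) 1 := hmem (i + 1) hi'
  set I := ∫ x in a..b, f x ^ 2 with hI
  have hbound : ∀ᵐ x, x ∈ uIoc a b → ‖(primL2 f - v : L2) x ^ 2‖ ≤ 1 / n * I := by
    have h1 : ∀ᵐ x ∂volΩ, x ∈ Ioo a b → (primL2 f - v : L2) x = primFun f x - primFun f a := by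
      filter_upwards [Lp.coeFn_sub (primL2 f) v, coeFn_primL2 f, hv'] with x h1 h2 h3 hx
      rw [h1, Pi.sub_apply, h2, h3 i hi' (by rw [hb] at hx; push_cast at hx; exact hx)]
    have h2 : ∀ᵐ t : ℝ, t ≠ b := by simp [ae_iff]
    filter_upwards [(ae_restrict_iff' measurableSet_Ioo).1 h1, h2] with x hx hxb hxab
    rw [uIoc_of_le hle] at hxab
    have hxlt : x < b := lt_of_le_of_ne hxab.2 hxb
    have hxm : x ∈ Icc (0 : ℝ) 1 := ⟨ham.1.trans hxab.1.le, hxab.2.trans hbm.2⟩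
    rw [hx ⟨ham.1.trans_lt hxab.1, hxlt.trans_le hbm.2⟩ ⟨hxab.1, hxlt⟩, Real.norm_eq_abs,
      abs_of_nonneg (sq_nonneg _), primFun, primFun, intervalIntegral.integral_interval_sub_left
        (f.intervalIntegrable_of_mem (by simp) hxm) (f.intervalIntegrable_of_mem (by simp) ham)]
    refine (sq_intervalIntegral_le hxab.1.le (f.intervalIntegrable_of_mem ham hxm)
      (f.intervalIntegrable_sq_of_mem ham hxm)).trans ?_
    have h3 : ∫ t in a..x, f t ^ 2 ≤ I :=
      intervalIntegral.integral_mono_interval le_rfl hxab.1.le hxab.2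
        (Eventually.of_forall fun t => sq_nonneg _) (f.intervalIntegrable_sq_of_mem ham hbm)
    have h4 : 0 ≤ ∫ t in a..x, f t ^ 2 :=
      intervalIntegral.integral_nonneg hxab.1.le fun t _ => sq_nonneg _
    have h5 : x - a ≤ 1 / n := by linarith
    exact mul_le_mul h5 h3 h4 (by positivity)
  have h := intervalIntegral.norm_integral_le_of_norm_le_const_ae hbound
  rw [hlen, abs_of_pos (by positivity)] at h
  refine (le_abs_self _).trans (h.trans (le_of_eq ?_))
  ring

/-! ### Splines with boundary conditions, and their primitives -/

lemma exists_polynomial_derivative_eq (P : Polynomial ℝ) :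
    ∃ Q : Polynomial ℝ, Q.natDegree ≤ P.natDegree + 1 ∧ Polynomial.derivative Q = P := by
  refine ⟨∑ k ∈ Finset.range (P.natDegree + 1),
    Polynomial.monomial (k + 1) (P.coeff k / (k + 1)), ?_, ?_⟩
  · refine Polynomial.natDegree_sum_le_of_forall_le _ _ fun k hk => ?_
    exact (Polynomial.natDegree_monomial_le _).trans (Finset.mem_range.1 hk)
  · conv_rhs => rw [P.as_sum_range]
    rw [Polynomial.derivative_sum]
    refine Finset.sum_congr rfl fun k _ => ?_
    rw [Polynomial.derivative_monomial, Nat.add_sub_cancel]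
    congr 1
    push_cast
    field_simp

/-- Splines of degree `q` and maximum smoothness on the uniform grid with `n` subintervals whose
derivatives of order less than `q` and congruent to `r` modulo `2` vanish at `0` and `1`. -/
structure IsParitySpline (n q r : ℕ) (s : ℝ → ℝ) : Prop where
  exists_polynomial : ∀ i < n, ∃ P : Polynomial ℝ, P.natDegree ≤ q ∧
    ∀ x ∈ Ioo ((i : ℝ) / n) (((i : ℝ) + 1) / n), s x = P.eval x
  -- The premise exempts step functions: at `q = 0` the truncated `q - 1` would demand continuity.
  contDiffOn : 1 ≤ q → ContDiffOn ℝ ((q - 1 : ℕ) : WithTop ℕ∞) s (Ioo 0 1)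
  tendsto : ∀ k < q, k % 2 = r → Tendsto (iteratedDeriv k s) (𝓝[>] 0) (𝓝 0) ∧
    Tendsto (iteratedDeriv k s) (𝓝[<] 1) (𝓝 0)

/-- Continuity is asked only on an open `U`, so that it applies both on `(0,1)` and on a single grid
cell, where degree `0` splines are continuous. -/
lemma hasDerivAt_primFun {s : ℝ → ℝ} (hs : IntervalIntegrable s volume 0 1) {U : Set ℝ}
    (hU : IsOpen U) (hsU : ContinuousOn s U) {x : ℝ} (hx : x ∈ Icc (0 : ℝ) 1) (hxU : x ∈ U) :
    HasDerivAt (primFun s) (s x) x := by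
  refine intervalIntegral.integral_hasDerivAt_right ?_
    (hsU.stronglyMeasurableAtFilter hU x hxU) (hsU.continuousAt (hU.mem_nhds hxU))
  refine hs.mono_set ?_
  rw [uIcc_of_le zero_le_one]
  exact uIcc_subset_Icc (by simp) hx

/-- Primitives of parity splines are parity splines of one degree more. -/
lemma IsParitySpline.primFun_add {n q r : ℕ} {s : ℝ → ℝ} (hs : IsParitySpline n q r s)
    (hr : r < 2) (hn : 0 < n) (hint : IntervalIntegrable s volume 0 1) {c : ℝ}
    (hc : r = 1 → c = 0 ∧ primFun s 1 = 0) :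
    IsParitySpline n (q + 1) (1 - r) (fun x => primFun s x + c) := by
  have hn' : (0 : ℝ) < n := by exact_mod_cast hn
  have hcont : ContinuousOn (fun x => primFun s x + c) (Icc 0 1) := by
    have h := (hint.absolutelyContinuousOnInterval_intervalIntegral
      (c := 0) (by simp)).continuousOn
    rw [uIcc_of_le zero_le_one] at h
    exact h.add continuousOn_const
  have hder : 1 ≤ q → ∀ x ∈ Ioo (0 : ℝ) 1, HasDerivAt (fun x => primFun s x + c) (s x) x :=
    fun hq x hx => (hasDerivAt_primFun hint isOpen_Ioo (hs.contDiffOn hq).continuousOn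
      (Ioo_subset_Icc_self hx) hx).add_const c
  refine ⟨fun i hi => ?_, fun _ => ?_, fun k hk hkr => ?_⟩
  · obtain ⟨P, hP, hsP⟩ := hs.exists_polynomial i hi
    obtain ⟨Q, hQ, hQP⟩ := exists_polynomial_derivative_eq P
    have hsub : Ioo ((i : ℝ) / n) (((i : ℝ) + 1) / n) ⊆ Icc 0 1 := fun x hx => by
      refine ⟨le_trans (by positivity) hx.1.le, hx.2.le.trans ?_⟩
      rw [div_le_one hn']
      exact_mod_cast hi
    have hsc : ContinuousOn s (Ioo ((i : ℝ) / n) (((i : ℝ) + 1) / n)) :=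
      P.continuous.continuousOn.congr hsP
    have hd : ∀ x ∈ Ioo ((i : ℝ) / n) (((i : ℝ) + 1) / n), HasDerivAt (primFun s) (s x) x :=
      fun x hx => hasDerivAt_primFun hint isOpen_Ioo hsc (hsub hx) hx
    -- On a cell the primitive of `s` and the polynomial `Q` have the same derivative, hence differ
    -- by a constant.
    obtain ⟨a, ha⟩ := isOpen_Ioo.exists_eq_add_of_deriv_eq isPreconnected_Ioo
      (fun x hx => (hd x hx).differentiableAt.differentiableWithinAt)
      Q.differentiableOn (fun x hx => by rw [(hd x hx).deriv, Q.deriv, hQP, hsP x hx])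
    refine ⟨Q + Polynomial.C (a + c), ?_, fun x hx => ?_⟩
    · rw [Polynomial.natDegree_add_C]
      exact hQ.trans (by omega)
    · have hax := ha hx
      simp only at hax
      simp only [Polynomial.eval_add, Polynomial.eval_C, hax]
      ring
  · rw [Nat.add_sub_cancel]
    cases q with
    | zero => exact contDiffOn_zero.2 (hcont.mono Ioo_subset_Icc_self)
    | succ q =>
      have hq : 1 ≤ q + 1 := by omega
      push_cast
      rw [contDiffOn_succ_iff_deriv_of_isOpen isOpen_Ioo]
      refine ⟨fun x hx => (hder hq x hx).differentiableAt.differentiableWithinAt,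
        fun h => by simp at h, ?_⟩
      exact (hs.contDiffOn hq).congr fun x hx => (hder hq x hx).deriv
  · cases k with
    | zero =>
      -- A condition on the values themselves arises only for `r = 1`; it holds because `c = 0` and
      -- the integral of `s` vanishes.
      obtain ⟨rfl, h1⟩ := hc (by omega)
      rw [iteratedDeriv_zero]
      constructor
      · have h := (hcont 0 (by simp)).mono_left (nhdsWithin_le_of_mem
          (Icc_mem_nhdsGT (zero_lt_one' ℝ)))
        simpa using h
      · have h := (hcont 1 (by simp)).mono_left (nhdsWithin_le_of_mem
          (Icc_mem_nhdsLT (zero_lt_one' ℝ)))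
        simpa [h1] using h
    | succ k =>
      obtain ⟨h0, h1⟩ := hs.tendsto k (by omega) (by omega)
      have e : ∀ x ∈ Ioo (0 : ℝ) 1, iteratedDeriv k s x
          = iteratedDeriv (k + 1) (fun x => primFun s x + c) x := fun x hx => by
        rw [iteratedDeriv_succ']
        refine Filter.EventuallyEq.iteratedDeriv_eq k ?_
        filter_upwards [isOpen_Ioo.mem_nhds hx] with y hy
        exact (hder (by omega) y hy).deriv.symm
      exact ⟨h0.congr' (eventually_of_mem (Ioo_mem_nhdsGT one_pos) e),
        h1.congr' (eventually_of_mem (Ioo_mem_nhdsLT one_pos) e)⟩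

/-- Integration raises the order of each boundary condition by one and so flips its parity. For `r =
1` the new order-zero condition forces a zero constant and zero mean, which is why `splinePair`
treats its two components differently. -/
lemma exists_isParitySpline_primL2_add {n q r : ℕ} {f : L2}
    (hf : ∃ s, IsParitySpline n q r s ∧ f =ᵐ[volΩ] s) (hr : r < 2) (hn : 0 < n) {c : ℝ}
    (hc : r = 1 → c = 0 ∧ ⟪oneL2, f⟫_ℝ = 0) :
    ∃ s, IsParitySpline n (q + 1) (1 - r) s ∧ (primL2 f + c • oneL2 : L2) =ᵐ[volΩ] s := by
  obtain ⟨s, hs, hfs⟩ := hf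
  have hint : IntervalIntegrable s volume 0 1 := by
    rw [intervalIntegrable_iff_integrableOn_Ioo_of_le zero_le_one]
    exact Integrable.congr ((Lp.memLp f).integrable (by norm_num)) hfs
  refine ⟨_, hs.primFun_add hr hn hint fun h => ⟨(hc h).1, ?_⟩, ?_⟩
  · rw [← primFun_congr hfs (by simp), ← inner_oneL2, (hc h).2]
  · filter_upwards [Lp.coeFn_add (primL2 f) (c • oneL2), Lp.coeFn_smul c oneL2, coeFn_oneL2,
      coeFn_primL2 f, ae_restrict_mem measurableSet_Ioo] with x h1 h2 h3 h4 hx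
    rw [h1, Pi.add_apply, h2, Pi.smul_apply, h3, h4, smul_eq_mul, mul_one,
      primFun_congr hfs (Ioo_subset_Icc_self hx)]

/-- Degree `0` carries no boundary condition, so either parity is available and both sequences can
start from step functions. -/
lemma exists_isParitySpline_of_mem_stepSpace {n : ℕ} (hn : 0 < n) (r : ℕ) {f : L2}
    (hf : f ∈ stepSpace n) : ∃ s, IsParitySpline n 0 r s ∧ f =ᵐ[volΩ] s := by
  obtain ⟨a, rfl⟩ := (Submodule.mem_span_range_iff_exists_fun ℝ).1 hf
  let A : ℕ → ℝ := fun i => if h : i < n then a ⟨i, h⟩ else 0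
  have hA : ∀ j : Fin n, A j = a j := fun j => by simp [A]
  refine ⟨fun x => ∑ j : Fin n, A j * piece n j 0 x,
    ⟨fun i hi => ⟨Polynomial.C (A i), by simp, fun x hx => ?_⟩, fun h => by omega,
      fun k hk => by omega⟩, ?_⟩
  · rw [sum_mul_piece hn A hi hx, Polynomial.eval_C]
  · have h1 : ∀ᵐ x ∂volΩ, ∀ j : Fin n,
        (a j • (memLp_piece n j 0).toLp (piece n j 0) : L2) x = A j * piece n j 0 x := by
      refine ae_all_iff.2 fun j => ?_
      filter_upwards [Lp.coeFn_smul (a j) ((memLp_piece n j 0).toLp (piece n j 0)),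
        (memLp_piece n j 0).coeFn_toLp] with x hx hx'
      rw [hx, Pi.smul_apply, hx', smul_eq_mul, hA]
    filter_upwards [h1, coeFn_sum_L2 Finset.univ
      (fun j : Fin n => a j • (memLp_piece n j 0).toLp (piece n j 0))] with x hx hx'
    rw [hx', Finset.sum_congr rfl fun j _ => hx j]

/-- The abstract even and odd spline spaces consist of splines. -/
lemma exists_isParitySpline_of_mem_splinePair {n : ℕ} (hn : 0 < n) (q : ℕ) :
    (∀ f ∈ (splinePair primL2 oneL2 (stepSpace n) q).1,
      ∃ s, IsParitySpline n q 1 s ∧ f =ᵐ[volΩ] s) ∧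
    (∀ f ∈ (splinePair primL2 oneL2 (stepSpace n) q).2,
      ∃ s, IsParitySpline n q 0 s ∧ f =ᵐ[volΩ] s) := by
  induction q with
  | zero =>
    exact ⟨fun f hf => exists_isParitySpline_of_mem_stepSpace hn 1 hf,
      fun f hf => exists_isParitySpline_of_mem_stepSpace hn 0 hf⟩
  | succ q ih =>
    constructor
    · intro f hf
      obtain ⟨_, ⟨σ, hσ, rfl⟩, _, hz, rfl⟩ := Submodule.mem_sup.1 hf
      obtain ⟨c, rfl⟩ := Submodule.mem_span_singleton.1 hz
      exact exists_isParitySpline_primL2_add (ih.2 σ hσ) (by norm_num) hn (by simp)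
    · rintro _ ⟨σ, ⟨hσ, hσ0⟩, rfl⟩
      have h := exists_isParitySpline_primL2_add (c := 0) (ih.1 σ hσ) (by norm_num) hn
        fun _ => ⟨rfl, Submodule.mem_orthogonal_singleton_iff_inner_right.1 hσ0⟩
      simpa using h

lemma IsParitySpline.mem_reducedSplineSpace {n p : ℕ} (hp : 1 ≤ p) {s : ℝ → ℝ}
    (hs : IsParitySpline n p 1 s) : s ∈ reducedSplineSpace p n :=
  ⟨⟨hs.contDiffOn hp, hs.exists_polynomial⟩, fun l hl => hs.tendsto _ hl (by omega)⟩

/-! ### The estimate in `H¹(0,1)` -/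

/-- The pair of an even spline and its derivative, as an element of the reduced spline space. -/
lemma exists_mem_reducedSplineH1 {n q : ℕ} (hn : 0 < n) {σ : L2}
    (hσ : σ ∈ (splinePair primL2 oneL2 (stepSpace n) q).2) (m : ℝ) :
    ∃ w ∈ reducedSplineH1 (q + 1) n,
      w.1.fst = primL2 σ + m • oneL2 ∧ w.1.snd = σ := by
  obtain ⟨s, hs, hes⟩ := exists_isParitySpline_primL2_add (c := m)
    ((exists_isParitySpline_of_mem_splinePair hn q).2 σ hσ) (by norm_num) hn (by simp)
  exact ⟨⟨WithLp.toLp 2 (primL2 σ + m • oneL2, σ), isWeakDeriv_primL2_add σ m⟩,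
    ⟨s, hs.mem_reducedSplineSpace (by omega), hes⟩, rfl, rfl⟩

/-- The `L²` norm of an `H¹` function which is `A`-orthogonal to the reduced spline space. -/
lemma norm_toL2_le_of_orthogonal {n q : ℕ} (hn : 0 < n) {e : H1}
    (he : ∀ w ∈ reducedSplineH1 (q + 1) n, ⟪e, w⟫_ℝ = 0) :
    ‖H1.toL2 e‖ ≤ √2 * (1 / n) * ‖e‖ := by
  have hn1 : (1 : ℝ) ≤ n := by exact_mod_cast hn
  obtain ⟨c, hc⟩ := exists_eq_smul_oneL2_add_primL2 (u := e.1.fst) (g := e.1.snd) e.2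
  have key := norm_le_of_orthogonal_splinePair (h := 1 / n) (q := q) inner_primL2_add norm_oneL2
    (oneL2_mem_stepSpace hn) (by positivity) (exists_stepSpace_norm_sub_le hn) hc
    fun σ hσ m => by
      obtain ⟨w, hw, hw1, hw2⟩ := exists_mem_reducedSplineH1 hn hσ m
      have h := he w hw
      rw [Submodule.coe_inner, WithLp.prod_inner_apply] at h
      rw [← hw1, ← hw2, real_inner_comm, real_inner_comm e.1.snd]
      exact h
  have hnorm : ‖e‖ ^ 2 = ‖e.1.fst‖ ^ 2 + ‖e.1.snd‖ ^ 2 := by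
    rw [← WithLp.prod_norm_sq_eq_of_L2]
    rfl
  change ‖e.1.fst‖ ≤ _
  set h : ℝ := 1 / n with hh
  have h0 : 0 ≤ h := by positivity
  -- Lets `h ^ 2` be absorbed into `h` in the duality estimate.
  have h1 : h ≤ 1 := by rw [hh, div_le_one (by linarith)]; exact hn1
  have h2 : ‖e.1.fst‖ + ‖e.1.snd‖ ≤ √2 * ‖e‖ := by
    refine le_of_sq_le_sq ?_ (by positivity)
    rw [mul_pow, Real.sq_sqrt (by norm_num), hnorm]
    nlinarith [sq_nonneg (‖e.1.fst‖ - ‖e.1.snd‖)]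
  calc ‖e.1.fst‖ ≤ h * ‖e.1.snd‖ + h ^ 2 * ‖e.1.fst‖ := key
    _ ≤ h * ‖e.1.snd‖ + h * ‖e.1.fst‖ := by
      gcongr
      nlinarith
    _ = h * (‖e.1.fst‖ + ‖e.1.snd‖) := by ring
    _ ≤ h * (√2 * ‖e‖) := by gcongr
    _ = √2 * h * ‖e‖ := by ring

end SplineApprox

end

theorem theorem4p2 (p n₀ ℓ : ℕ) (hp : 1 ≤ p) (hn : p < n₀) (u : SplineApprox.H1) :
    ‖SplineApprox.H1.toL2 (u - SplineApprox.splineProjector p n₀ ℓ hn u)‖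
      ≤ 2 * √2 * (1 / ((n₀ : ℝ) * 2 ^ ℓ)) * ‖u‖ := by
  obtain ⟨q, rfl⟩ : ∃ q, p = q + 1 := ⟨p - 1, by omega⟩
  have hpos : 0 < n₀ * 2 ^ ℓ := Nat.mul_pos (by omega) (Nat.two_pow_pos ℓ)
  have := SplineApprox.finiteDimensional_reducedSplineH1 (q + 1) hpos
  have h := SplineApprox.norm_toL2_le_of_orthogonal (q := q) hpos
    (e := u - (SplineApprox.reducedSplineH1 (q + 1) (n₀ * 2 ^ ℓ)).starProjection u)
    fun w hw => Submodule.starProjection_inner_eq_zero u w hw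
  push_cast at h
  refine h.trans ?_
  have h1 : 0 ≤ √2 * (1 / ((n₀ : ℝ) * 2 ^ ℓ)) := by positivity
  -- The projection error is no larger than `u` in the `H¹` norm; this already gives the constant
  -- `√2`, so the factor `2` is slack.
  have h2 := SplineApprox.norm_sub_starProjection_self_le
    (K := SplineApprox.reducedSplineH1 (q + 1) (n₀ * 2 ^ ℓ)) u
  nlinarith [mul_le_mul_of_nonneg_left h2 h1, mul_nonneg h1 (norm_nonneg u)]
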